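/- Let $n\ge 2$ and $I=\{1,\dots,n\}$. For each $i\in I$ let $(T_i,\mathcal T_i,\lambda_i)$ be a probability space and $\mathcal F_i\subseteq\mathcal T_i$ a sub-$\sigma$-algebra which is countably generated up to $\lambda_i$-null sets and such that $(T_i,\mathcal F_i,\lambda_i)$ is atomless. Let $T=\prod_i T_i$. Let $X$ be an infinite compact metric space, and let $\Gamma_n(X)$ be the collection of all Bayesian games with player set $I$, common action space $X$, private type spaces $(T_i,\mathcal T_i)$, a common prior $\lambda$ on $(T,\otimes_i\mathcal T_i)$ which has marginals $\lambda_i$ and is absolutely continuous with respect to $\otimes_i\lambda_i$ (with density $q$), and continuous payoffs $u_i\colon X^n\to\mathbb R$ that do not depend on the types. Write $w_i(a,t)=u_i(a)\,q(t)$ for the density-weighted payoffs. Such a game has payoff-relevant information $(\mathcal F_i)_{i\in I}$ if, for some version of $q$, every $w_i(a,\cdot)$ is $\otimes_\ell\mathcal F_\ell$-measurable. Its density-weighted payoffs are decomposable if, for some version of $q$, there are an integer $J\ge1$ and functions $w_i^j,\rho_\ell^j$ with $$w_i(a,t)=\sum_{j=1}^J w_i^j(a,t)\prod_{\ell\in I}\rho_\ell^j(t_\ell)\qquad\text{for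 all } i,a,t,$$ where each $w_i^j(a,\cdot)$ is $\otimes_\ell\mathcal F_\ell$-measurable and $\otimes_\ell\lambda_\ell$-integrable, and each $\rho_\ell^j$ is nonnegative, $\mathcal T_\ell$-measurable and $\lambda_\ell$-integrable. The $\sigma$-algebra $\mathcal T_i$ is nowhere equivalent to $\mathcal F_i$ under $\lambda_i$ if for every $D\in\mathcal T_i$ with $\lambda_i(D)>0$ the family of all sets $E\triangle E_0$, with $E\in\{D\cap D' : D'\in\mathcal F_i\}$ and $E_0\subseteq D$ a $\lambda_i$-null set of $\mathcal T_i$, is different from $\{D\cap D' : D'\in\mathcal T_i\}$. A game has decomposable coarser payoff-relevant information (DCPI) if every $\mathcal T_i$ is nowhere equivalent to $\mathcal F_i$ under $\lambda_i$ and its density-weighted payoffs are decomposable. Suppose that every game in $\Gamma_n(X)$ with payoff-relevant information $(\mathcal F_i)_{i\in I}$ has a pure-strategy equilibrium (this is the case, in particular, if every game in $\Gamma_n(X)$ has one). Then the DCPI condition holds: $\mathcal T_i$ is nowhere equivalent to $\mathcal F_i$ under $\lambda_i$ for every $i\in I$, and hence every game in $\Gamma_n(X)$ whose density-weighted payoffs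 are decomposable has DCPI. -/

import Mathlib

open MeasureTheory

/- Throughout, the σ-algebra `F` is bound before the ambient instance, so that everything not marked
explicitly with `F` refers to the ambient σ-algebra. -/

section NowhereEquivalence

variable {Ω : Type*}

/-- The trace `{D ∩ D' | D' ∈ F}` of a σ-algebra `F` on a set `D`, as a family of subsets of `Ω`. -/
def traceFamily (F : MeasurableSpace Ω) (D : Set Ω) : Set (Set Ω) :=
  {B | ∃ D' : Set Ω, MeasurableSet[F] D' ∧ B = D ∩ D'}

/-- The strong completion of `F^D` in `𝒯^D` under `P`: all sets `E ∆ E₀` with `E ∈ F^D` and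
`E₀ ∈ 𝒯^D` a `P`-null set. The σ-algebra `𝒯` is the ambient one. -/
def strongCompletion (F : MeasurableSpace Ω) [mΩ : MeasurableSpace Ω] (P : Measure Ω)
    (D : Set Ω) : Set (Set Ω) :=
  {B | ∃ E ∈ traceFamily F D, ∃ E₀ ∈ traceFamily mΩ D, P E₀ = 0 ∧ B = symmDiff E E₀}

/-- The ambient σ-algebra `𝒯` is nowhere equivalent to `F` under `P`. -/
def NowhereEquivalent (F : MeasurableSpace Ω) [mΩ : MeasurableSpace Ω] (P : Measure Ω) : Prop :=
  ∀ D : Set Ω, MeasurableSet D → 0 < P D → strongCompletion F P D ≠ traceFamily mΩ D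

/-- The measure space `(Ω, F, P)` is atomless: every set of `F` of positive measure
contains a set of `F` of positive and strictly smaller measure. -/
def AtomlessOn (F : MeasurableSpace Ω) [mΩ : MeasurableSpace Ω] (P : Measure Ω) : Prop :=
  ∀ E : Set Ω, MeasurableSet[F] E → 0 < P E →
    ∃ E' : Set Ω, MeasurableSet[F] E' ∧ E' ⊆ E ∧ 0 < P E' ∧ P E' < P E

/-- `F` is countably generated up to `P`-null sets. -/
def EssentiallyCountablyGenerated (F : MeasurableSpace Ω) [mΩ : MeasurableSpace Ω]
    (P : Measure Ω) : Prop :=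
  ∃ F₀ : MeasurableSpace Ω, F₀ ≤ F ∧ @MeasurableSpace.CountablyGenerated Ω F₀ ∧
    ∀ E : Set Ω, MeasurableSet[F] E →
      ∃ E' : Set Ω, MeasurableSet[F₀] E' ∧ P (symmDiff E E') = 0

end NowhereEquivalence

/-- A Bayesian game with players `Fin n`, private type spaces `T i` (with their full σ-algebras)
and action spaces `A i`. The common prior is absolutely continuous with respect to the product of
its marginals; payoffs are jointly measurable and integrably bounded. -/
structure BayesianGame (n : ℕ) (T A : Fin n → Type*)
    [∀ i, MeasurableSpace (T i)] [∀ i, MeasurableSpace (A i)] where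
  /-- the common prior -/
  prior : Measure (∀ i, T i)
  isProbabilityMeasure_prior : IsProbabilityMeasure prior
  absolutelyContinuous_prior :
    prior ≪ Measure.pi (fun i => prior.map (fun t : ∀ i, T i => t i))
  /-- `payoff i a t` is the payoff of player `i` at the action profile `a` and type profile `t` -/
  payoff : Fin n → (∀ i, A i) → (∀ i, T i) → ℝ
  measurable_payoff : ∀ i,
    Measurable (fun p : (∀ i, A i) × (∀ i, T i) => payoff i p.1 p.2)
  integrably_bounded : ∀ i, ∃ h : (∀ i, T i) → ℝ,
    Integrable h prior ∧ ∀ a t, |payoff i a t| ≤ h t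

namespace BayesianGame

section

variable {n : ℕ} {T A : Fin n → Type*}
  [∀ i, MeasurableSpace (T i)] [∀ i, MeasurableSpace (A i)]

/-- The marginal of the common prior on the private type space of player `i`. -/
noncomputable def marginal (G : BayesianGame n T A) (i : Fin n) : Measure (T i) :=
  G.prior.map (fun t : ∀ i, T i => t i)

/-- The product of the marginals. -/
noncomputable def productMeasure (G : BayesianGame n T A) : Measure (∀ i, T i) :=
  Measure.pi (fun i => G.marginal i)

/-- `q` is a (version of the) Radon-Nikodym derivative of the common prior with respect to the
product of the marginals. -/
def IsDensity (G : BayesianGame n T A) (q : (∀ i, T i) → ℝ) : Prop :=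
  Measurable q ∧ (∀ t, 0 ≤ q t) ∧
    G.prior = G.productMeasure.withDensity (fun t => ENNReal.ofReal (q t))

/-- The expected payoff of player `i` at a pure-strategy profile `f`. -/
noncomputable def expectedPayoff (G : BayesianGame n T A) (i : Fin n)
    (f : ∀ i, T i → A i) : ℝ :=
  ∫ t, G.payoff i (fun j => f j (t j)) t ∂G.prior

/-- `f` is a pure-strategy equilibrium: each `f i` is a pure strategy (a measurable map) which
maximizes the expected payoff of player `i` given the strategies of the others. -/
def IsPureStrategyEquilibrium (G : BayesianGame n T A) (f : ∀ i, T i → A i) : Prop :=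
  (∀ i, Measurable (f i)) ∧
    ∀ (i : Fin n) (g : T i → A i), Measurable g →
      G.expectedPayoff i (Function.update f i g) ≤ G.expectedPayoff i f

/-- The collection of all Bayesian games with players `Fin n`, common action set `X`, private type
spaces `T i` with laws `P i`, and type-irrelevant continuous payoffs. -/
def typeIrrelevantGames (X : Type*) [TopologicalSpace X] [MeasurableSpace X]
    (P : ∀ i, Measure (T i)) : Set (BayesianGame n T (fun _ => X)) :=
  {G | (∀ i, G.marginal i = P i) ∧
    ∃ v : Fin n → (Fin n → X) → ℝ,
      (∀ i, Continuous (v i)) ∧ ∀ i a t, G.payoff i a t = v i a}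

end

section

variable {n : ℕ} {T A : Fin n → Type*} (F : ∀ i, MeasurableSpace (T i))
  [mT : ∀ i, MeasurableSpace (T i)] [mA : ∀ i, MeasurableSpace (A i)]

/-- The payoff-relevant information of the players is contained in the σ-algebras `F i`: with a
suitable version of the density `q`, all density-weighted payoffs
`w_i(a, ·) = u_i(a, ·) q(·)` are measurable with respect to `⊗ F i`. -/
def HasPayoffRelevantInformation (G : BayesianGame n T A) : Prop :=
  ∃ q : (∀ i, T i) → ℝ, G.IsDensity q ∧
    ∀ (i : Fin n) (a : ∀ i, A i),
      Measurable[@MeasurableSpace.pi (Fin n) T F] (fun t => G.payoff i a t * q t)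

/-- With a suitable version of the density `q`, the density-weighted payoffs
`w_i(a, t) = u_i(a, t) q(t)` are finite sums `∑ j, w_i^j(a, t) ∏ ℓ, ρ_ℓ^j(t_ℓ)` with
`w_i^j(a, ·)` measurable for `⊗ F i` and integrable, and `ρ_ℓ^j` nonnegative, measurable for the
full σ-algebra on `T ℓ`, and integrable. -/
def HasDecomposablePayoffs (G : BayesianGame n T A) : Prop :=
  ∃ q : (∀ i, T i) → ℝ, G.IsDensity q ∧
    ∃ J : ℕ, 0 < J ∧
      ∃ (w : Fin n → Fin J → (∀ i, A i) → (∀ i, T i) → ℝ) (ρ : Fin J → ∀ l, T l → ℝ),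
        (∀ i a t, G.payoff i a t * q t = ∑ j, w i j a t * ∏ l, ρ j l (t l)) ∧
        (∀ i j a, Measurable[@MeasurableSpace.pi (Fin n) T F] (w i j a) ∧
          Integrable (w i j a) G.productMeasure) ∧
        (∀ j l, (∀ s, 0 ≤ ρ j l s) ∧ Measurable (ρ j l) ∧ Integrable (ρ j l) (G.marginal l))

/-- Decomposable coarser payoff-relevant information, relative to the σ-algebras `F i`. -/
def HasDCPI (G : BayesianGame n T A) : Prop :=
  (∀ i, NowhereEquivalent (F i) (G.marginal i)) ∧ G.HasDecomposablePayoffs F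

end

end BayesianGame

/-! ### Disjoint sequences, determining algebras, independent partitions -/

section NullSets

variable {Ω : Type*}

/-! Equilibrium in one well-chosen game forces a player `i₀` to randomize by means of private
information independent of `F i₀`. Fix an opponent `j₀` and `K` points of `X`. The two play zero-sum
matching on these points, with a penalty for leaving them, and their types have density `1 + ∑
2^{-(m+1)} a_m(x) e_m(y)`. Here the `a_m` are centred indicators of sets `A_m` that determine `F i₀`
up to null sets, and the `e_m` are centred, measurable for `F j₀` and separated by sets `B_m` of
types of `j₀`. The density is measurable for the product of the `F i`, so the hypothesis supplies an
equilibrium. At the equilibrium `j₀` gains nothing by playing a fixed point on the event `B_m`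
(`IsPureStrategyEquilibrium.duel`). Since `B_m` isolates the `m`-th term of the series, the cells
where `i₀` plays the various points each have conditional probability `1 / K` on `A_m`, hence on all
of `F i₀` (`exists_uniform_partition_of_exists_equilibrium`). If the ambient σ-algebra and `F i₀`
agreed on a set `D`, these cells would be traces on `D` of sets of `F i₀`, which forces `P D ≤ 1 /
K` (`measure_le_of_strongCompletion_eq`). With `K` large this contradicts `0 < P D`. -/

theorem AtomlessOn.exists_disjoint_seq {F : MeasurableSpace Ω} [mΩ : MeasurableSpace Ω]
    (hF : F ≤ mΩ) {P : Measure Ω} [IsProbabilityMeasure P] (h : AtomlessOn F P) :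
    ∃ C : ℕ → Set Ω, (∀ m, MeasurableSet[F] (C m)) ∧ (∀ m k, m < k → Disjoint (C m) (C k)) ∧
      ∀ m, 0 < P (C m) := by
  choose s hsm hsub hpos hlt using h
  let σ : Type _ := {E : Set Ω // MeasurableSet[F] E ∧ 0 < P E}
  -- Removing the chosen piece leaves positive mass because the piece is strictly smaller. All later
  -- pieces lie in the remainder.
  let next : σ → σ := fun E => ⟨E.1 \ s E.1 E.2.1 E.2.2, E.2.1.diff (hsm _ _ _), by
    rw [measure_sdiff (hsub _ _ _) (hF _ (hsm _ _ _)).nullMeasurableSet (measure_ne_top _ _)]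
    exact tsub_pos_of_lt (hlt _ _ _)⟩
  let E : ℕ → σ := fun m => Nat.rec ⟨Set.univ, MeasurableSet.univ, by simp⟩ (fun _ => next) m
  have hE : ∀ m, E (m + 1) = next (E m) := fun m => rfl
  have hanti : Antitone fun m => (E m).1 :=
    antitone_nat_of_succ_le fun m => by rw [hE]; exact Set.sdiff_subset
  refine ⟨fun m => s (E m).1 (E m).2.1 (E m).2.2, fun m => hsm _ _ _, fun m k hmk => ?_,
    fun m => hpos _ _ _⟩
  have h1 : s (E k).1 (E k).2.1 (E k).2.2 ⊆ (E (m + 1)).1 := (hsub _ _ _).trans (hanti hmk)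
  rw [hE] at h1
  exact (Set.disjoint_sdiff_left.mono_left h1).symm

/-- A countable generating family generates a countable algebra, which is a π-system. Two finite
measures of equal mass that agree on it agree on `F₀`, and null-set approximation extends this to
`F`. -/
theorem EssentiallyCountablyGenerated.exists_determining_seq {F : MeasurableSpace Ω}
    [mΩ : MeasurableSpace Ω] (hF : F ≤ mΩ) {P : Measure Ω} [IsProbabilityMeasure P]
    (h : EssentiallyCountablyGenerated F P) :
    ∃ A : ℕ → Set Ω, (∀ m, MeasurableSet[F] (A m)) ∧
      ∀ (Φ : Set Ω) (c : ENNReal), MeasurableSet Φ →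
        (∀ m, P (Φ ∩ A m) = c * P (A m)) → P Φ = c →
        ∀ E, MeasurableSet[F] E → P (Φ ∩ E) = c * P E := by
  obtain ⟨F₀, hF₀, hcg, happ⟩ := h
  obtain ⟨b, hb, hgen⟩ := hcg.isCountablyGenerated
  have halg := isSetAlgebra_generateSetAlgebra (𝒜 := b)
  obtain ⟨A, hA⟩ := (countable_generateSetAlgebra hb).exists_eq_range ⟨_, halg.empty_mem⟩
  have hgen' : F₀ = MeasurableSpace.generateFrom (generateSetAlgebra b) := by
    rw [generateFrom_generateSetAlgebra_eq, hgen]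
  have hAm : ∀ m, MeasurableSet[F₀] (A m) := fun m => by
    rw [hgen']
    exact MeasurableSpace.measurableSet_generateFrom (hA ▸ Set.mem_range_self m)
  refine ⟨A, fun m => hF₀ _ (hAm m), fun Φ c hΦ hAΦ hc E hE => ?_⟩
  have hle := hF₀.trans hF
  have key : (P.restrict Φ).trim hle = (c • P).trim hle := by
    refine ext_of_generate_finite _ hgen' (fun s hs t ht _ => halg.inter_mem hs ht) ?_ ?_
    · intro s hs
      rw [hA] at hs
      obtain ⟨m, rfl⟩ := hs
      rw [trim_measurableSet_eq _ (hAm m), trim_measurableSet_eq _ (hAm m),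
        Measure.restrict_apply (hle _ (hAm m)), Set.inter_comm, hAΦ]
      simp
    · rw [trim_measurableSet_eq _ MeasurableSet.univ, trim_measurableSet_eq _ MeasurableSet.univ]
      simp [hc]
  obtain ⟨E', hE', hEE'⟩ := happ E hE
  have hae : E =ᵐ[P] E' := measure_symmDiff_eq_zero_iff.1 hEE'
  have h2 := congrArg (fun μ => μ E') key
  simp only [trim_measurableSet_eq hle hE', Measure.restrict_apply (hle _ hE')] at h2
  rw [measure_congr ((Filter.EventuallyEq.refl _ Φ).inter hae), measure_congr hae, Set.inter_comm,
    h2]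
  simp

/-- If a partition into `K` cells of equal conditional probability is independent of `F`, then
no set of measure larger than `1 / K` can carry only the information in `F`. -/
theorem measure_le_of_strongCompletion_eq {F : MeasurableSpace Ω} [mΩ : MeasurableSpace Ω]
    (hF : F ≤ mΩ) {P : Measure Ω} [IsProbabilityMeasure P] {D : Set Ω}
    (h : strongCompletion F P D = traceFamily mΩ D) {K : ℕ} {Φ : Fin K → Set Ω}
    (hΦ : ∀ l, MeasurableSet (Φ l)) (hdisj : ∀ l k, l ≠ k → Disjoint (Φ l) (Φ k))
    (hcover : ∀ᵐ x ∂P, ∃ l, x ∈ Φ l)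
    (hind : ∀ l E, MeasurableSet[F] E → P (Φ l ∩ E) = (K : ENNReal)⁻¹ * P E) :
    P D ≤ (K : ENNReal)⁻¹ := by
  have hex : ∀ l, ∃ E : Set Ω, MeasurableSet[F] E ∧ ∀ᵐ x ∂P, x ∈ D → (x ∈ Φ l ↔ x ∈ E) := by
    intro l
    have hmem : D ∩ Φ l ∈ strongCompletion F P D := by
      rw [h]; exact ⟨Φ l, hΦ l, rfl⟩
    obtain ⟨_, ⟨E, hE, rfl⟩, E₀, _, hE₀, heq⟩ := hmem
    refine ⟨E, hE, ?_⟩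
    filter_upwards [measure_eq_zero_iff_ae_notMem.1 hE₀] with x hx hxD
    have := congrArg (x ∈ ·) heq
    simp only [Set.mem_inter_iff, Set.mem_symmDiff, hx, hxD, true_and, not_false_eq_true,
      and_true, false_and, or_false] at this
    exact this.to_iff
  choose E hE hEae using hex
  -- The `E l` may overlap off `D`. Discarding every overlap stays within `F`, costs only a null set
  -- inside `D`, and makes the final sum a measure of a disjoint union.
  let E' : Fin K → Set Ω := fun l => E l \ ⋃ k ∈ {k | k ≠ l}, E k
  have hE' : ∀ l, MeasurableSet[F] (E' l) := fun l =>
    (hE l).diff (MeasurableSet.biUnion (Set.to_countable _) fun k _ => hE k)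
  have hE'disj : Pairwise (Function.onFun Disjoint E') := by
    intro l k hlk
    refine Set.disjoint_left.2 fun x hx hx' => hx'.2 ?_
    exact Set.mem_biUnion (show l ∈ {j | j ≠ k} from hlk) hx.1
  have hsub : D ≤ᵐ[P] ⋃ l, Φ l ∩ E' l := by
    filter_upwards [hcover, ae_all_iff.2 hEae] with x ⟨l, hl⟩ hx hxD
    refine Set.mem_iUnion.2 ⟨l, hl, (hx l hxD).1 hl, ?_⟩
    simp only [Set.mem_iUnion, not_exists]
    intro k hk hxk
    exact Set.disjoint_left.1 (hdisj k l hk) ((hx k hxD).2 hxk) hl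
  calc P D ≤ P (⋃ l, Φ l ∩ E' l) := measure_mono_ae hsub
    _ ≤ ∑ l, P (Φ l ∩ E' l) := measure_iUnion_fintype_le _ _
    _ = (K : ENNReal)⁻¹ * ∑ l, P (E' l) := by
        rw [Finset.mul_sum]; exact Finset.sum_congr rfl fun l _ => hind l _ (hE' l)
    _ = (K : ENNReal)⁻¹ * P (⋃ l, E' l) := by
        rw [measure_iUnion hE'disj fun l => hF _ (hE' l), tsum_fintype]
    _ ≤ (K : ENNReal)⁻¹ := mul_le_of_le_one_right' prob_le_one

end NullSets

/-! ### Coupling densities and the functions that build them -/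

section CouplingDensity

variable {α β : Type*}

/-- A density on a product space which perturbs the constant `1` by a series of products. -/
noncomputable def couplingDensity (a : ℕ → α → ℝ) (e : ℕ → β → ℝ) (x : α) (y : β) : ℝ :=
  1 + ∑' m, (1 / 2 : ℝ) ^ (m + 1) * (a m x * e m y)

theorem couplingDensity_swap (a : ℕ → α → ℝ) (e : ℕ → β → ℝ) (x : α) (y : β) :
    couplingDensity a e x y = couplingDensity e a y x := by
  simp only [couplingDensity, mul_comm (a _ x)]

theorem hasSum_half_pow_succ : HasSum (fun m : ℕ => (1 / 2 : ℝ) ^ (m + 1)) 1 := by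
  simpa [pow_succ', div_eq_mul_inv] using hasSum_geometric_two' (1 : ℝ)

theorem abs_couplingDensity_term_le {r s : ℝ} (hr : |r| ≤ 1) (hs : |s| ≤ 1) (m : ℕ) :
    |(1 / 2 : ℝ) ^ (m + 1) * (r * s)| ≤ (1 / 2 : ℝ) ^ (m + 1) := by
  rw [abs_mul, abs_mul, abs_of_pos (by positivity : (0 : ℝ) < (1 / 2) ^ (m + 1))]
  exact mul_le_of_le_one_right (by positivity) (mul_le_one₀ hr (abs_nonneg _) hs)

theorem measurable_couplingDensity [MeasurableSpace α] [MeasurableSpace β]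
    {a : ℕ → α → ℝ} {e : ℕ → β → ℝ} (ha : ∀ m, Measurable (a m)) (he : ∀ m, Measurable (e m)) :
    Measurable fun p : α × β => couplingDensity a e p.1 p.2 := by
  unfold couplingDensity
  exact (Measurable.tsum fun m => by have := ha m; have := he m; fun_prop).const_add 1

variable {a : ℕ → α → ℝ} {e : ℕ → β → ℝ}

theorem abs_couplingDensity_sub_one_le (ha : ∀ m x, |a m x| ≤ 1) (he : ∀ m y, |e m y| ≤ 1)
    (x : α) (y : β) : |couplingDensity a e x y - 1| ≤ 1 := by
  rw [couplingDensity, add_sub_cancel_left, ← Real.norm_eq_abs]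
  exact tsum_of_norm_bounded hasSum_half_pow_succ fun m =>
    abs_couplingDensity_term_le (ha m x) (he m y) m

theorem couplingDensity_nonneg (ha : ∀ m x, |a m x| ≤ 1) (he : ∀ m y, |e m y| ≤ 1)
    (x : α) (y : β) : 0 ≤ couplingDensity a e x y := by
  linarith [(abs_le.1 (abs_couplingDensity_sub_one_le ha he x y)).1]

/-- Domination by `2^{-(m+1)}` permits termwise integration. A set `B` that annihilates all but one
`e m` thereby extracts a single `a m`. -/
theorem setIntegral_couplingDensity [MeasurableSpace β] (ν : Measure β) [IsProbabilityMeasure ν]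
    (ha : ∀ m x, |a m x| ≤ 1) (he : ∀ m y, |e m y| ≤ 1) (hem : ∀ m, Measurable (e m))
    (B : Set β) (x : α) :
    ∫ y in B, couplingDensity a e x y ∂ν =
      ν.real B + ∑' m, (1 / 2 : ℝ) ^ (m + 1) * (a m x * ∫ y in B, e m y ∂ν) := by
  have hint : ∀ m, Integrable (fun y => (1 / 2 : ℝ) ^ (m + 1) * (a m x * e m y))
      (ν.restrict B) := fun m =>
    Integrable.of_bound (by have := hem m; fun_prop) ((1 / 2 : ℝ) ^ (m + 1))
      (Filter.Eventually.of_forall fun y => abs_couplingDensity_term_le (ha m x) (he m y) m)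
  have hsum : Summable fun m =>
      ∫ y in B, ‖(1 / 2 : ℝ) ^ (m + 1) * (a m x * e m y)‖ ∂ν := by
    refine Summable.of_nonneg_of_le (fun m => integral_nonneg fun y => norm_nonneg _) (fun m => ?_)
      hasSum_half_pow_succ.summable
    calc _ ≤ ∫ y in B, (1 / 2 : ℝ) ^ (m + 1) ∂ν :=
          integral_mono (hint m).norm (integrable_const _)
            fun y => abs_couplingDensity_term_le (ha m x) (he m y) m
      _ ≤ (1 / 2 : ℝ) ^ (m + 1) := by
          rw [setIntegral_const, smul_eq_mul]
          exact mul_le_of_le_one_left (by positivity) measureReal_le_one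
  have hS := hasSum_integral_of_summable_integral_norm hint hsum
  have hI : Integrable (fun y => ∑' m, (1 / 2 : ℝ) ^ (m + 1) * (a m x * e m y))
      (ν.restrict B) := by
    refine Integrable.of_bound (Measurable.tsum fun m => by
      have := hem m; fun_prop).aestronglyMeasurable 1 (Filter.Eventually.of_forall fun y => ?_)
    exact tsum_of_norm_bounded hasSum_half_pow_succ fun m =>
      abs_couplingDensity_term_le (ha m x) (he m y) m
  unfold couplingDensity
  rw [integral_add (integrable_const _) hI, ← hS.tsum_eq]
  simp [integral_const_mul]

theorem integral_couplingDensity_eq_one [MeasurableSpace β] (ν : Measure β)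
    [IsProbabilityMeasure ν]
    (ha : ∀ m x, |a m x| ≤ 1) (he : ∀ m y, |e m y| ≤ 1) (hem : ∀ m, Measurable (e m))
    (h0 : ∀ m, ∫ y, e m y ∂ν = 0) (x : α) :
    ∫ y, couplingDensity a e x y ∂ν = 1 := by
  simpa [h0] using setIntegral_couplingDensity ν ha he hem Set.univ x

end CouplingDensity

/-- On an atomless space there is a bounded sequence of centred functions such that each of them is
singled out by integration over a suitable set. -/
theorem AtomlessOn.exists_separated_seq {Ω : Type*} {F : MeasurableSpace Ω}
    [mΩ : MeasurableSpace Ω] (hF : F ≤ mΩ) {P : Measure Ω} [IsProbabilityMeasure P]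
    (h : AtomlessOn F P) :
    ∃ (e : ℕ → Ω → ℝ) (B : ℕ → Set Ω), (∀ m, Measurable[F] (e m)) ∧ (∀ m y, |e m y| ≤ 1) ∧
      (∀ m, ∫ y, e m y ∂P = 0) ∧ (∀ m, MeasurableSet (B m)) ∧
      (∀ m, ∫ y in B m, e m y ∂P ≠ 0) ∧ ∀ m k, k ≠ m → ∫ y in B m, e k y ∂P = 0 := by
  obtain ⟨C, hCm, hCd, hCpos⟩ := h.exists_disjoint_seq hF
  have hCd' : ∀ m k, m ≠ k → Disjoint (C m) (C k) := fun m k hmk =>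
    hmk.lt_or_gt.elim (hCd m k) fun h => (hCd k m h).symm
  have hCm' : ∀ m, MeasurableSet (C m) := fun m => hF _ (hCm m)
  have hpos : ∀ m, 0 < P.real (C m) := fun m =>
    ENNReal.toReal_pos (hCpos m).ne' (measure_ne_top _ _)
  -- Cross-weighting two disjoint cells by each other's mass centres `e m`. Distinct indices use
  -- distinct pairs, so `C (2 * m)` sees only `e m`.
  let e : ℕ → Ω → ℝ := fun m => fun y =>
    (C (2 * m)).indicator (fun _ => P.real (C (2 * m + 1))) y -
      (C (2 * m + 1)).indicator (fun _ => P.real (C (2 * m))) y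
  have hint : ∀ (B : Set Ω) (m : ℕ), MeasurableSet B → ∫ y in B, e m y ∂P =
      P.real (C (2 * m) ∩ B) * P.real (C (2 * m + 1)) -
        P.real (C (2 * m + 1) ∩ B) * P.real (C (2 * m)) := by
    intro B m hB
    rw [integral_sub ((integrable_const _).indicator (hCm' _))
      ((integrable_const _).indicator (hCm' _)), integral_indicator_const _ (hCm' _),
      integral_indicator_const _ (hCm' _), measureReal_restrict_apply (hCm' _),
      measureReal_restrict_apply (hCm' _)]
    simp
  refine ⟨e, fun m => C (2 * m), fun m => ?_, fun m y => ?_, fun m => ?_, fun m => hCm' _,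
    fun m => ?_, fun m k hk => ?_⟩
  · exact (measurable_const.indicator (hCm _)).sub (measurable_const.indicator (hCm _))
  · have h1 : ∀ k, P.real (C k) ≤ 1 := fun k => measureReal_le_one
    have h2 := h1 (2 * m)
    have h3 := h1 (2 * m + 1)
    have h4 := (hpos (2 * m)).le
    have h5 := (hpos (2 * m + 1)).le
    by_cases hy : y ∈ C (2 * m) <;> by_cases hy' : y ∈ C (2 * m + 1) <;>
      simp only [e, Set.indicator_of_mem, Set.indicator_of_notMem, hy, hy', not_false_eq_true,
        abs_le] <;> constructor <;> linarith
  · rw [← setIntegral_univ, hint _ _ MeasurableSet.univ]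
    simp only [Set.inter_univ]
    ring
  · rw [hint _ _ (hCm' _), Set.inter_self,
      (hCd' (2 * m + 1) (2 * m) (by omega)).inter_eq]
    simpa using ⟨(hpos _).ne', (hpos _).ne'⟩
  · rw [hint _ _ (hCm' _), (hCd' (2 * k) (2 * m) (by omega)).inter_eq,
      (hCd' (2 * k + 1) (2 * m) (by omega)).inter_eq]
    simp

/-- Finitely many points of a metric space can be interpolated by continuous functions, and are the
exact maximizers of a continuous function. -/
theorem exists_continuous_interpolation {X : Type*} [MetricSpace X] {K : ℕ} (p : Fin K → X)
    (hp : Function.Injective p) :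
    ∃ (S : X → ℝ) (b : Fin K → X → ℝ), Continuous S ∧ (∀ k, Continuous (b k)) ∧
      (∀ x, S x ≤ 0) ∧ (∀ x, S x = 0 ↔ ∃ k, x = p k) ∧
      ∀ k l, b k (p l) = if k = l then 1 else 0 := by
  classical
  -- Lagrange interpolation with distances in place of differences.
  refine ⟨fun x => -∏ k, dist x (p k),
    fun k x => ∏ l ∈ Finset.univ.erase k, dist x (p l) / dist (p k) (p l), by fun_prop,
    fun k => by fun_prop, fun x => ?_, fun x => ?_, fun k l => ?_⟩
  · simpa using Finset.prod_nonneg fun k _ => dist_nonneg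
  · simp [Finset.prod_eq_zero_iff]
  · split_ifs with hkl
    · subst hkl
      refine Finset.prod_eq_one fun j hj => div_self (dist_ne_zero.2 fun h => ?_)
      exact (Finset.ne_of_mem_erase hj) (hp h).symm
    · exact Finset.prod_eq_zero (i := l)
        (Finset.mem_erase.2 ⟨fun h => hkl h.symm, Finset.mem_univ l⟩) (by simp)

/-! ### Marginals of product measures and of their perturbations -/

section ProductMarginals

open ProbabilityTheory

variable {n : ℕ} {T : Fin n → Type*} [∀ i, MeasurableSpace (T i)]
  (P : ∀ i, Measure (T i)) [∀ i, IsProbabilityMeasure (P i)]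

theorem iIndepFun_eval_pi : iIndepFun (fun (i : Fin n) (t : ∀ i, T i) => t i) (Measure.pi P) :=
  iIndepFun_pi (X := fun _ => id) fun _ => aemeasurable_id

theorem map_eval_pi (i : Fin n) : (Measure.pi P).map (fun t : ∀ i, T i => t i) = P i :=
  (measurePreserving_eval P i).map_eq

theorem map_eval_prodMk_pi {i j : Fin n} (hij : i ≠ j) :
    (Measure.pi P).map (fun t : ∀ i, T i => (t i, t j)) = (P i).prod (P j) := by
  rw [((iIndepFun_eval_pi P).indepFun hij).map_prod_eq_prod_map_map
    (measurable_pi_apply i).aemeasurable (measurable_pi_apply j).aemeasurable, map_eval_pi,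
    map_eval_pi]

/-- The coordinate `t j` is independent of `(t i, t k)`, so integrating it out first turns the
density into `1`. The case `i = k` is allowed and covers the correlated partner. -/
theorem map_eval_withDensity_pi {i j k : Fin n} (hij : i ≠ j) (hkj : k ≠ j)
    (q : T k → T j → ENNReal) (hq : Measurable fun p : T k × T j => q p.1 p.2)
    (h1 : ∀ x, ∫⁻ y, q x y ∂P j = 1) :
    ((Measure.pi P).withDensity fun t => q (t k) (t j)).map (fun t : ∀ i, T i => t i) = P i := by
  have hmi : Measurable fun t : ∀ i, T i => t i := measurable_pi_apply i
  ext s hs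
  rw [Measure.map_apply hmi hs, withDensity_apply _ (hmi hs), ← lintegral_indicator (hmi hs)]
  let g : (T i × T k) × T j → ENNReal := fun z => s.indicator 1 z.1.1 * q z.1.2 z.2
  have hg : Measurable g := ((measurable_one.indicator hs).comp
    (measurable_fst.comp measurable_fst)).mul (hq.comp (by fun_prop : Measurable
      fun z : (T i × T k) × T j => (z.1.2, z.2)))
  have hind := ((iIndepFun_eval_pi P).indepFun_prodMk (fun i => measurable_pi_apply i) i k j hij
    hkj).map_prod_eq_prod_map_map
      ((measurable_pi_apply i).prodMk (measurable_pi_apply k)).aemeasurable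
      (measurable_pi_apply j).aemeasurable
  rw [map_eval_pi] at hind
  calc _ = ∫⁻ t, g ((t i, t k), t j) ∂Measure.pi P := by
        refine lintegral_congr fun t => ?_
        by_cases h : t i ∈ s <;> simp [g, h]
    _ = ∫⁻ z, g z ∂((Measure.pi P).map fun t : ∀ i, T i => ((t i, t k), t j)) :=
        (lintegral_map hg (by fun_prop)).symm
    _ = ∫⁻ z, s.indicator 1 z.1 ∂((Measure.pi P).map fun t : ∀ i, T i => (t i, t k)) := by
        rw [hind, lintegral_prod _ hg.aemeasurable]
        refine lintegral_congr fun z => ?_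
        have hqz : Measurable fun y => q z.2 y :=
          hq.comp (by fun_prop : Measurable fun y : T j => (z.2, y))
        simp only [g]
        rw [lintegral_const_mul _ hqz, h1, mul_one]
    _ = ∫⁻ t, s.indicator 1 (t i) ∂Measure.pi P :=
        lintegral_map ((measurable_one.indicator hs).comp measurable_fst) (by fun_prop)
    _ = ∫⁻ x, s.indicator 1 x ∂P i := by
        rw [← map_eval_pi P i, lintegral_map (measurable_one.indicator hs) hmi]
    _ = P i s := by simp [lintegral_indicator_one hs]

end ProductMarginals

/-! ### The zero-sum matching game on `K` points -/

/-- Matching payoffs: the bilinear form of the matrix `δ k l - 1 / K` in the coordinates `b`. -/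
noncomputable def matchingPayoff {X : Type*} {K : ℕ} (b : Fin K → X → ℝ) (x y : X) : ℝ :=
  ∑ k, b k x * b k y - (K : ℝ)⁻¹ * ((∑ k, b k x) * ∑ k, b k y)

section MatchingPayoff

variable {X : Type*} {K : ℕ} {b : Fin K → X → ℝ}

theorem continuous_matchingPayoff [TopologicalSpace X] (hb : ∀ k, Continuous (b k)) :
    Continuous fun z : X × X => matchingPayoff b z.1 z.2 := by
  unfold matchingPayoff
  fun_prop

theorem matchingPayoff_comm (x y : X) : matchingPayoff b x y = matchingPayoff b y x := by
  simp only [matchingPayoff, mul_comm (b _ x), mul_comm (∑ k, b k x)]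

variable {p : Fin K → X}

theorem matchingPayoff_apply_right
    (hbp : ∀ k l, b k (p l) = if k = l then 1 else 0) (x : X) (l : Fin K) :
    matchingPayoff b x (p l) = b l x - (K : ℝ)⁻¹ * ∑ k, b k x := by
  simp [matchingPayoff, hbp]

/-- Uniform mixing over the `p l` yields zero against every action in `X`, not only against the `p
k`: this is what the correction by `1 / K` achieves. -/
theorem sum_matchingPayoff_right
    (hbp : ∀ k l, b k (p l) = if k = l then 1 else 0) (hK : K ≠ 0) (x : X) :
    ∑ l, matchingPayoff b x (p l) = 0 := by
  have : (K : ℝ) ≠ 0 := by exact_mod_cast hK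
  simp only [matchingPayoff_apply_right hbp, Finset.sum_sub_distrib, Finset.sum_const,
    Finset.card_univ, Fintype.card_fin, nsmul_eq_mul]
  field_simp
  simp

theorem sum_matchingPayoff_left
    (hbp : ∀ k l, b k (p l) = if k = l then 1 else 0) (hK : K ≠ 0) (y : X) :
    ∑ k, matchingPayoff b (p k) y = 0 := by
  simp only [matchingPayoff_comm _ y, sum_matchingPayoff_right hbp hK]

theorem matchingPayoff_apply_apply
    (hbp : ∀ k l, b k (p l) = if k = l then 1 else 0) (k l : Fin K) :
    matchingPayoff b (p k) (p l) = (if k = l then 1 else 0) - (K : ℝ)⁻¹ := by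
  simp [matchingPayoff_apply_right hbp, hbp, eq_comm]

end MatchingPayoff

/-- Payoffs in which `i₀` and `j₀` play a zero-sum matching game with stakes `W`, augmented by own
action payoffs `S`, and all other players are dummies. -/
noncomputable def duelPayoff {n : ℕ} {X : Type*} (i₀ j₀ : Fin n) (S : X → ℝ) (W : X → X → ℝ)
    (i : Fin n) (a : Fin n → X) : ℝ :=
  if i = i₀ then S (a i₀) + W (a i₀) (a j₀)
  else if i = j₀ then S (a j₀) - W (a i₀) (a j₀) else 0

theorem continuous_duelPayoff {n : ℕ} {X : Type*} [TopologicalSpace X] {i₀ j₀ : Fin n}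
    {S : X → ℝ} {W : X → X → ℝ} (hS : Continuous S)
    (hW : Continuous fun z : X × X => W z.1 z.2) (i : Fin n) :
    Continuous (duelPayoff i₀ j₀ S W i) := by
  have hW' : Continuous fun a : Fin n → X => W (a i₀) (a j₀) :=
    hW.comp (by fun_prop : Continuous fun a : Fin n → X => (a i₀, a j₀))
  unfold duelPayoff
  split_ifs <;> fun_prop

section Duel

open BayesianGame

variable {n : ℕ} {T : Fin n → Type*} [∀ i, MeasurableSpace (T i)]
  {X : Type*} [MetricSpace X] [CompactSpace X] [MeasurableSpace X] [BorelSpace X]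

theorem integrable_comp_of_continuous {Ω : Type*} [MeasurableSpace Ω] {μ : Measure Ω}
    [IsFiniteMeasure μ] {Y : Type*} [TopologicalSpace Y] [CompactSpace Y] [MeasurableSpace Y]
    [OpensMeasurableSpace Y] {h : Y → ℝ} (hh : Continuous h) {u : Ω → Y} (hu : Measurable u) :
    Integrable (fun t => h (u t)) μ := by
  obtain ⟨C, hC⟩ := isCompact_univ.exists_bound_of_continuousOn hh.continuousOn
  exact Integrable.of_bound (hh.measurable.comp hu).aestronglyMeasurable C
    (Filter.Eventually.of_forall fun t => hC _ (Set.mem_univ _))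

/-- Averaging deviations over the `p k` shows that `i₀` gets at least `0` overall and `j₀` at least
`0` on every event `B`. The `W` terms cancel and `S ≤ 0`, so the payoffs sum to at most `0` and all
these bounds are equalities. The averaged deviations of `j₀` on `B` are then individually zero. -/
theorem BayesianGame.IsPureStrategyEquilibrium.duel
    {G : BayesianGame n T fun _ => X} {i₀ j₀ : Fin n} (hij : i₀ ≠ j₀)
    {S : X → ℝ} {W : X → X → ℝ} (hS : Continuous S) (hW : Continuous fun z : X × X => W z.1 z.2)
    (hG : ∀ i a t, G.payoff i a t = duelPayoff i₀ j₀ S W i a)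
    {K : ℕ} (hK : K ≠ 0) {p : Fin K → X} (hS0 : ∀ x, S x ≤ 0) (hSp : ∀ k, S (p k) = 0)
    (hWl : ∀ y, ∑ k, W (p k) y = 0) (hWr : ∀ x, ∑ k, W x (p k) = 0)
    {f : ∀ i, T i → X} (hf : G.IsPureStrategyEquilibrium f) :
    (∀ᵐ t ∂G.prior, S (f i₀ (t i₀)) = 0) ∧
      ∀ (B : Set (T j₀)), MeasurableSet B → ∀ l,
        ∫ t in {t | t j₀ ∈ B}, W (f i₀ (t i₀)) (p l) ∂G.prior = 0 := by
  have := G.isProbabilityMeasure_prior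
  have hKpos : (0 : ℝ) < K := by exact_mod_cast Nat.pos_of_ne_zero hK
  obtain ⟨hfm, hopt⟩ := hf
  have hm : ∀ i, Measurable fun t : ∀ i, T i => f i (t i) := fun i =>
    (hfm i).comp (measurable_pi_apply i)
  have hSint : ∀ i, Integrable (fun t : ∀ i, T i => S (f i (t i))) G.prior := fun i =>
    integrable_comp_of_continuous hS (hm i)
  have hWint : ∀ u v : (∀ i, T i) → X, Measurable u → Measurable v →
      Integrable (fun t => W (u t) (v t)) G.prior := fun u v hu hv =>
    integrable_comp_of_continuous hW (hu.prodMk hv)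
  have hWf := hWint _ _ (hm i₀) (hm j₀)
  have hU1 : G.expectedPayoff i₀ f = ∫ t, S (f i₀ (t i₀)) ∂G.prior +
      ∫ t, W (f i₀ (t i₀)) (f j₀ (t j₀)) ∂G.prior := by
    simp only [expectedPayoff, hG, duelPayoff, if_true]
    exact integral_add (hSint _) hWf
  -- constant deviations of `i₀`
  have hA : 0 ≤ ∫ t, S (f i₀ (t i₀)) ∂G.prior +
      ∫ t, W (f i₀ (t i₀)) (f j₀ (t j₀)) ∂G.prior := by
    have hdev : ∀ k, ∫ t, W (p k) (f j₀ (t j₀)) ∂G.prior ≤ G.expectedPayoff i₀ f := fun k => by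
      have := hopt i₀ (fun _ => p k) measurable_const
      simpa [expectedPayoff, hG, duelPayoff, Function.update_of_ne hij.symm, hSp] using this
    have hsum : ∑ k, ∫ t, W (p k) (f j₀ (t j₀)) ∂G.prior = 0 := by
      rw [← integral_finsetSum _ fun k _ => hWint _ _ measurable_const (hm j₀)]
      simp [hWl]
    have := Finset.sum_le_sum fun k (_ : k ∈ Finset.univ) => hdev k
    rw [hsum, Finset.sum_const, Finset.card_univ, Fintype.card_fin, nsmul_eq_mul] at this
    rw [← hU1]
    exact nonneg_of_mul_nonneg_right this hKpos
  -- deviations of `j₀` on a set of types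
  have hB : ∀ B : Set (T j₀), MeasurableSet B → ∀ l,
      -∫ t in {t | t j₀ ∈ B}, W (f i₀ (t i₀)) (p l) ∂G.prior ≤
        ∫ t in {t | t j₀ ∈ B}, S (f j₀ (t j₀)) - W (f i₀ (t i₀)) (f j₀ (t j₀)) ∂G.prior := by
    classical
    intro B hB l
    have hB' : MeasurableSet {t : ∀ i, T i | t j₀ ∈ B} := measurable_pi_apply j₀ hB
    let g : T j₀ → X := B.piecewise (fun _ => p l) (f j₀)
    have hg : Measurable g := measurable_const.piecewise hB (hfm j₀)
    have hgm : Measurable fun t : ∀ i, T i => g (t j₀) := hg.comp (measurable_pi_apply j₀)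
    have hdev := hopt j₀ g hg
    simp only [expectedPayoff, hG, duelPayoff, if_neg hij.symm, if_true, Function.update_self,
      Function.update_of_ne hij] at hdev
    have hi1 : Integrable (fun t : ∀ i, T i => S (g (t j₀)) - W (f i₀ (t i₀)) (g (t j₀)))
        G.prior := (integrable_comp_of_continuous hS hgm).sub (hWint _ _ (hm i₀) hgm)
    have hi2 : Integrable (fun t : ∀ i, T i => S (f j₀ (t j₀)) - W (f i₀ (t i₀)) (f j₀ (t j₀)))
        G.prior := (hSint _).sub hWf
    -- The deviation changes nothing off `B`, so the contributions of the complement cancel.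
    rw [← integral_add_compl hB' hi1, ← integral_add_compl hB' hi2,
      setIntegral_congr_fun hB'.compl (g := fun t : ∀ i, T i =>
        S (f j₀ (t j₀)) - W (f i₀ (t i₀)) (f j₀ (t j₀)))
        (fun t ht => by simp [g, Set.piecewise_eq_of_notMem B _ _ ht])] at hdev
    refine le_trans (le_of_eq ?_) (le_of_add_le_add_right hdev)
    rw [← integral_neg]
    refine setIntegral_congr_fun hB' fun t ht => ?_
    simp [g, Set.piecewise_eq_of_mem B _ _ ht, hSp]
  have hsumr : ∀ B : Set (T j₀),
      ∑ l, ∫ t in {t | t j₀ ∈ B}, W (f i₀ (t i₀)) (p l) ∂G.prior = 0 := fun B => by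
    rw [← integral_finsetSum _ fun k _ =>
      (hWint _ _ (hm i₀) measurable_const).integrableOn]
    simp [hWr]
  have hB2 : ∀ B : Set (T j₀), MeasurableSet B → 0 ≤
      ∫ t in {t | t j₀ ∈ B}, S (f j₀ (t j₀)) - W (f i₀ (t i₀)) (f j₀ (t j₀)) ∂G.prior := by
    intro B hBm
    have := Finset.sum_le_sum fun l (_ : l ∈ Finset.univ) => hB B hBm l
    rw [Finset.sum_neg_distrib, hsumr, neg_zero, Finset.sum_const, Finset.card_univ,
      Fintype.card_fin, nsmul_eq_mul] at this
    exact nonneg_of_mul_nonneg_right this hKpos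
  have htot : ∀ B : Set (T j₀), MeasurableSet B →
      ∫ t in {t | t j₀ ∈ B}, S (f j₀ (t j₀)) - W (f i₀ (t i₀)) (f j₀ (t j₀)) ∂G.prior +
        ∫ t in {t : ∀ i, T i | t j₀ ∈ B}ᶜ,
          S (f j₀ (t j₀)) - W (f i₀ (t i₀)) (f j₀ (t j₀)) ∂G.prior =
      ∫ t, S (f j₀ (t j₀)) ∂G.prior - ∫ t, W (f i₀ (t i₀)) (f j₀ (t j₀)) ∂G.prior := by
    intro B hBm
    rw [← integral_sub (hSint j₀) hWf]
    exact integral_add_compl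
      (measurable_pi_apply j₀ hBm : MeasurableSet {t : ∀ i, T i | t j₀ ∈ B}) ((hSint j₀).sub hWf)
  have hS1 : ∫ t, S (f i₀ (t i₀)) ∂G.prior ≤ 0 := integral_nonpos fun t => hS0 _
  have hS2 : ∫ t, S (f j₀ (t j₀)) ∂G.prior ≤ 0 := integral_nonpos fun t => hS0 _
  have hcompl : ∀ B : Set (T j₀), MeasurableSet B → 0 ≤ ∫ t in {t : ∀ i, T i | t j₀ ∈ B}ᶜ,
      S (f j₀ (t j₀)) - W (f i₀ (t i₀)) (f j₀ (t j₀)) ∂G.prior := fun B hBm => hB2 Bᶜ hBm.compl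
  -- Adding both players' lower bounds gives a nonnegative sum of two nonpositive `S` integrals.
  have hS1' : ∫ t, S (f i₀ (t i₀)) ∂G.prior = 0 := by
    linarith [htot _ MeasurableSet.univ, hB2 _ MeasurableSet.univ, hcompl _ MeasurableSet.univ]
  refine ⟨?_, fun B hBm l => ?_⟩
  · have := (integral_eq_zero_iff_of_nonneg (fun t : ∀ i, T i => neg_nonneg.2 (hS0 (f i₀ (t i₀))))
      (hSint i₀).neg).1 (by rw [integral_neg, hS1', neg_zero])
    filter_upwards [this] with t ht
    simpa using ht
  · have hzero : ∫ t in {t | t j₀ ∈ B}, S (f j₀ (t j₀)) - W (f i₀ (t i₀)) (f j₀ (t j₀)) ∂G.prior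
        ≤ 0 := by linarith [htot B hBm, hcompl B hBm]
    have hnn : ∀ l ∈ Finset.univ,
        0 ≤ ∫ t in {t | t j₀ ∈ B}, W (f i₀ (t i₀)) (p l) ∂G.prior := fun l _ => by
      linarith [hB B hBm l]
    exact (Finset.sum_eq_zero_iff_of_nonneg hnn).1 (hsumr B) l (Finset.mem_univ l)

end Duel

/-! ### The game with a prescribed two-player correlation -/

namespace BayesianGame

variable {n : ℕ} {T : Fin n → Type*} [∀ i, MeasurableSpace (T i)]

/-- The game with type-irrelevant continuous payoffs `v` in which only the types of two players are
correlated. -/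
theorem exists_typeIrrelevant_of_density
    (P : ∀ i, Measure (T i)) [∀ i, IsProbabilityMeasure (P i)] {i₀ j₀ : Fin n} (hij : i₀ ≠ j₀)
    (q : T i₀ → T j₀ → ℝ) (hq : Measurable fun z : T i₀ × T j₀ => q z.1 z.2)
    (hq0 : ∀ x y, 0 ≤ q x y) (hi₁ : ∀ x, Integrable (q x) (P j₀))
    (hi₂ : ∀ y, Integrable (fun x => q x y) (P i₀))
    (h₁ : ∀ x, ∫ y, q x y ∂P j₀ = 1) (h₂ : ∀ y, ∫ x, q x y ∂P i₀ = 1)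
    {X : Type*} [MetricSpace X] [CompactSpace X] [MeasurableSpace X] [BorelSpace X]
    (v : Fin n → (Fin n → X) → ℝ) (hv : ∀ i, Continuous (v i)) :
    ∃ G : BayesianGame n T fun _ => X, G ∈ typeIrrelevantGames X P ∧
      (∀ i a t, G.payoff i a t = v i a) ∧ G.IsDensity (fun t => q (t i₀) (t j₀)) ∧
      G.prior = (Measure.pi P).withDensity fun t => ENNReal.ofReal (q (t i₀) (t j₀)) := by
  let π := (Measure.pi P).withDensity fun t => ENNReal.ofReal (q (t i₀) (t j₀))
  have hqe : Measurable fun z : T i₀ × T j₀ => ENNReal.ofReal (q z.1 z.2) := hq.ennreal_ofReal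
  have hqt : Measurable fun t : ∀ i, T i => q (t i₀) (t j₀) :=
    hq.comp ((measurable_pi_apply i₀).prodMk (measurable_pi_apply j₀))
  have hmarg : ∀ i, π.map (fun t : ∀ i, T i => t i) = P i := by
    intro i
    by_cases hi : i = j₀
    · subst hi
      refine map_eval_withDensity_pi P hij.symm hij.symm
        (fun y x => ENNReal.ofReal (q x y)) (hqe.comp measurable_swap) fun y => ?_
      rw [← ofReal_integral_eq_lintegral_ofReal (hi₂ y)
        (Filter.Eventually.of_forall fun x => hq0 x y), h₂, ENNReal.ofReal_one]
    · refine map_eval_withDensity_pi P hi hij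
        (fun x y => ENNReal.ofReal (q x y)) hqe fun x => ?_
      rw [← ofReal_integral_eq_lintegral_ofReal (hi₁ x)
        (Filter.Eventually.of_forall fun y => hq0 x y), h₁, ENNReal.ofReal_one]
  have hπ : IsProbabilityMeasure π := by
    refine ⟨?_⟩
    have := congrArg (fun μ => μ Set.univ) (hmarg i₀)
    simpa [Measure.map_apply (measurable_pi_apply i₀) MeasurableSet.univ] using this
  let G : BayesianGame n T fun _ => X :=
    { prior := π
      isProbabilityMeasure_prior := hπ
      absolutelyContinuous_prior := by
        simp only [hmarg]
        exact withDensity_absolutelyContinuous _ _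
      payoff := fun i a _ => v i a
      measurable_payoff := fun i => (hv i).measurable.comp measurable_fst
      integrably_bounded := fun i => by
        obtain ⟨C, hC⟩ := isCompact_univ.exists_bound_of_continuousOn (hv i).continuousOn
        exact ⟨fun _ => C, integrable_const _, fun a _ => hC a (Set.mem_univ a)⟩ }
  refine ⟨G, ⟨hmarg, v, hv, fun _ _ _ => rfl⟩, fun _ _ _ => rfl,
    ⟨hqt, fun t => hq0 _ _, ?_⟩, rfl⟩
  have : G.productMeasure = Measure.pi P := congrArg Measure.pi (funext hmarg)
  rw [this]

end BayesianGame

theorem setIntegral_withDensity_pi {n : ℕ} {T : Fin n → Type*} [∀ i, MeasurableSpace (T i)]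
    (P : ∀ i, Measure (T i)) [∀ i, IsProbabilityMeasure (P i)] {i₀ j₀ : Fin n} (hij : i₀ ≠ j₀)
    {q : T i₀ → T j₀ → ℝ} (hq : Measurable fun z : T i₀ × T j₀ => q z.1 z.2)
    (hq0 : ∀ x y, 0 ≤ q x y) (hqC : ∀ x y, q x y ≤ 2)
    {g : T i₀ → ℝ} (hg : Measurable g) {C : ℝ} (hgC : ∀ x, |g x| ≤ C)
    {B : Set (T j₀)} (hB : MeasurableSet B) :
    ∫ t in {t | t j₀ ∈ B}, g (t i₀)
        ∂((Measure.pi P).withDensity fun t => ENNReal.ofReal (q (t i₀) (t j₀))) =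
      ∫ x, g x * ∫ y in B, q x y ∂P j₀ ∂P i₀ := by
  have hB' : MeasurableSet {t : ∀ i, T i | t j₀ ∈ B} := measurable_pi_apply j₀ hB
  have hpair : Measurable fun t : ∀ i, T i => (t i₀, t j₀) :=
    (measurable_pi_apply i₀).prodMk (measurable_pi_apply j₀)
  have hqe : Measurable fun t : ∀ i, T i => ENNReal.ofReal (q (t i₀) (t j₀)) :=
    (hq.comp hpair).ennreal_ofReal
  -- The integrand depends on two coordinates only. The bounds on `q` and `g` make it integrable, so
  -- Fubini applies.
  let h : T i₀ × T j₀ → ℝ := fun z => g z.1 * B.indicator (fun y => q z.1 y) z.2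
  have hh : Measurable h := by
    have : Measurable fun z : T i₀ × T j₀ => B.indicator (fun y => q z.1 y) z.2 := by
      have := hq.indicator (measurable_snd hB : MeasurableSet {z : T i₀ × T j₀ | z.2 ∈ B})
      exact this
    exact (hg.comp measurable_fst).mul this
  have hhint : Integrable h ((P i₀).prod (P j₀)) := by
    refine Integrable.of_bound hh.aestronglyMeasurable (C * 2)
      (Filter.Eventually.of_forall fun z => ?_)
    have h1 : |B.indicator (fun y => q z.1 y) z.2| ≤ 2 := by
      by_cases hz : z.2 ∈ B
      · simpa [hz, abs_of_nonneg (hq0 _ _)] using hqC _ _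
      · simp [hz]
    rw [Real.norm_eq_abs, abs_mul]
    exact mul_le_mul (hgC _) h1 (abs_nonneg _) ((abs_nonneg _).trans (hgC z.1))
  rw [setIntegral_withDensity_eq_setIntegral_toReal_smul
    hqe (Filter.Eventually.of_forall fun _ => ENNReal.ofReal_lt_top) _
    hB', ← integral_indicator hB']
  calc _ = ∫ t, h (t i₀, t j₀) ∂Measure.pi P := by
        refine integral_congr_ae (Filter.Eventually.of_forall fun t => ?_)
        by_cases ht : t j₀ ∈ B
        · simp [h, ht, ENNReal.toReal_ofReal (hq0 _ _), mul_comm]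
        · simp [h, ht]
    _ = ∫ z, h z ∂(P i₀).prod (P j₀) := by
        rw [← map_eval_prodMk_pi P hij, integral_map hpair.aemeasurable hh.aestronglyMeasurable]
    _ = _ := by
        rw [integral_prod _ hhint]
        refine integral_congr_ae (Filter.Eventually.of_forall fun x => ?_)
        simp only [h]
        rw [integral_const_mul, integral_indicator hB]

/-! ### From equilibrium to independent partitions, and the theorem -/

/-- If every game with payoff-relevant information `F` has a pure-strategy equilibrium, then for
each `K` the types of a player can be partitioned into `K` cells of equal conditional probability
given `F`. -/
theorem exists_uniform_partition_of_exists_equilibrium {n : ℕ} {T : Fin n → Type*}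
    {F : ∀ i, MeasurableSpace (T i)}
    [mT : ∀ i, MeasurableSpace (T i)] (hF : ∀ i, F i ≤ mT i)
    (P : ∀ i, Measure (T i)) [∀ i, IsProbabilityMeasure (P i)]
    {X : Type*} [MetricSpace X] [CompactSpace X] [Infinite X] [MeasurableSpace X] [BorelSpace X]
    (hexists : ∀ G ∈ BayesianGame.typeIrrelevantGames X P, G.HasPayoffRelevantInformation F →
      ∃ f, G.IsPureStrategyEquilibrium f)
    {i₀ j₀ : Fin n} (hij : i₀ ≠ j₀) (hatomless : AtomlessOn (F j₀) (P j₀))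
    (hcg : EssentiallyCountablyGenerated (F i₀) (P i₀)) {K : ℕ} (hK : K ≠ 0) :
    ∃ Φ : Fin K → Set (T i₀), (∀ l, MeasurableSet (Φ l)) ∧
      (∀ l k, l ≠ k → Disjoint (Φ l) (Φ k)) ∧ (∀ᵐ x ∂P i₀, ∃ l, x ∈ Φ l) ∧
      ∀ l E, MeasurableSet[F i₀] E → P i₀ (Φ l ∩ E) = (K : ENNReal)⁻¹ * P i₀ E := by
  obtain ⟨A, hA, hAdet⟩ := hcg.exists_determining_seq (hF i₀)
  obtain ⟨e, B, hem, he1, he0, hBm, heB, heB'⟩ := hatomless.exists_separated_seq (hF j₀)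
  have hAm : ∀ m, MeasurableSet (A m) := fun m => hF _ _ (hA m)
  have hem' : ∀ m, Measurable (e m) := fun m => (hem m).mono (hF _) le_rfl
  let a : ℕ → T i₀ → ℝ := fun m x => (A m).indicator (fun _ => 1) x - (P i₀).real (A m)
  have haF : ∀ m, Measurable[F i₀] (a m) := fun m =>
    (measurable_const.indicator (hA m)).sub measurable_const
  have ham : ∀ m, Measurable (a m) := fun m => (haF m).mono (hF _) le_rfl
  have ha1 : ∀ m x, |a m x| ≤ 1 := fun m x => by
    have h1 : (P i₀).real (A m) ≤ 1 := measureReal_le_one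
    have h2 : 0 ≤ (P i₀).real (A m) := measureReal_nonneg
    by_cases hx : x ∈ A m <;>
      simp only [a, hx, Set.indicator_of_mem, Set.indicator_of_notMem, not_false_eq_true,
        abs_le] <;> constructor <;> linarith
  have ha0 : ∀ m, ∫ x, a m x ∂P i₀ = 0 := fun m => by
    rw [integral_sub ((integrable_const (1 : ℝ)).indicator (hAm m)) (integrable_const _)]
    simp [integral_indicator_const (1 : ℝ) (hAm m)]
  let q := couplingDensity a e
  have hq : Measurable fun z : T i₀ × T j₀ => q z.1 z.2 := measurable_couplingDensity ham hem'
  have hq0 : ∀ x y, 0 ≤ q x y := couplingDensity_nonneg ha1 he1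
  have hq2 : ∀ x y, q x y ≤ 2 := fun x y => by
    linarith [(abs_le.1 (abs_couplingDensity_sub_one_le ha1 he1 x y)).2]
  have hqabs : ∀ x y, ‖q x y‖ ≤ 2 := fun x y => by
    rw [Real.norm_of_nonneg (hq0 x y)]; exact hq2 x y
  obtain ⟨p⟩ : Nonempty (Fin K ↪ X) := ⟨Fin.valEmbedding.trans (Infinite.natEmbedding X)⟩
  obtain ⟨S, b, hS, hb, hS0, hSp, hbp⟩ := exists_continuous_interpolation p p.injective
  have hW := continuous_matchingPayoff hb
  obtain ⟨G, hGmem, hGpay, hGq, hGprior⟩ :=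
    BayesianGame.exists_typeIrrelevant_of_density P hij q hq hq0
      (fun x => Integrable.of_bound
        (hq.comp (measurable_const.prodMk measurable_id)).aestronglyMeasurable 2
        (Filter.Eventually.of_forall fun y => hqabs x y))
      (fun y => Integrable.of_bound
        (hq.comp (measurable_id.prodMk measurable_const)).aestronglyMeasurable 2
        (Filter.Eventually.of_forall fun x => hqabs x y))
      (integral_couplingDensity_eq_one (P j₀) ha1 he1 hem' he0)
      (fun y => by
        simp only [q, couplingDensity_swap a e]
        exact integral_couplingDensity_eq_one (P i₀) he1 ha1 ham ha0 y)
      (duelPayoff i₀ j₀ S (matchingPayoff b)) (continuous_duelPayoff hS hW)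
  -- Payoffs are constant in the types, and `q` is built from functions measurable for `F i₀` and `F
  -- j₀`.
  obtain ⟨f, hf⟩ := hexists G hGmem ⟨_, hGq, fun i c => by
    have hqF : Measurable[@MeasurableSpace.pi (Fin n) T F] fun t : ∀ i, T i => q (t i₀) (t j₀) :=
      (@measurable_couplingDensity _ _ (F i₀) (F j₀) a e haF hem).comp
        (Measurable.prodMk (@measurable_pi_apply _ _ F i₀) (@measurable_pi_apply _ _ F j₀))
    simp only [hGpay]
    exact measurable_const.mul hqF⟩
  obtain ⟨hae, hzero⟩ := hf.duel hij hS hW hGpay hK hS0 (fun k => (hSp _).2 ⟨k, rfl⟩)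
    (sum_matchingPayoff_left hbp hK) (sum_matchingPayoff_right hbp hK)
  have hfm : Measurable (f i₀) := hf.1 i₀
  have hcover : ∀ᵐ x ∂P i₀, ∃ l, f i₀ x = p l := by
    rw [← hGmem.1 i₀, BayesianGame.marginal, ae_map_iff (measurable_pi_apply i₀).aemeasurable]
    · filter_upwards [hae] with t ht using (hSp _).1 ht
    · rw [Set.ofPred_exists]
      exact MeasurableSet.iUnion fun l => hfm (measurableSet_singleton (p l))
  let Φ : Fin K → Set (T i₀) := fun l => f i₀ ⁻¹' {p l}
  have hΦ : ∀ l, MeasurableSet (Φ l) := fun l => hfm (measurableSet_singleton _)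
  refine ⟨Φ, hΦ, fun l k hlk => ?_, hcover, fun l => ?_⟩
  · refine Set.disjoint_left.2 fun x hx hx' => hlk (p.injective ?_)
    exact (Set.mem_singleton_iff.1 hx).symm.trans hx'
  -- Almost surely `g` is the indicator of `Φ l` minus `1 / K`, so a vanishing integral over `E` is
  -- exactly the required identity on `E`.
  let g : T i₀ → ℝ := fun x => matchingPayoff b (f i₀ x) (p l)
  have hWl : Continuous fun x => matchingPayoff b x (p l) :=
    hW.comp (continuous_id.prodMk continuous_const)
  have hg : Measurable g := hWl.measurable.comp hfm
  have hgint : Integrable g (P i₀) := integrable_comp_of_continuous hWl hfm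
  obtain ⟨C, hC⟩ := isCompact_univ.exists_bound_of_continuousOn hWl.continuousOn
  have hgB : ∀ B : Set (T j₀), MeasurableSet B →
      ∫ x, g x * ∫ y in B, q x y ∂P j₀ ∂P i₀ = 0 := fun B hB => by
    rw [← setIntegral_withDensity_pi P hij hq hq0 hq2 hg
      (fun x => hC (f i₀ x) (Set.mem_univ _)) hB, ← hGprior]
    exact hzero B hB l
  have hgΦ : g =ᵐ[P i₀] fun x => (Φ l).indicator (fun _ => (1 : ℝ)) x - (K : ℝ)⁻¹ := by
    filter_upwards [hcover] with x ⟨k, hk⟩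
    simp only [g, hk, matchingPayoff_apply_apply hbp]
    by_cases hkl : k = l
    · subst hkl; simp [Φ, hk]
    · simp [Φ, hk, hkl]
  have hgE : ∀ E, MeasurableSet E →
      ∫ x in E, g x ∂P i₀ = (P i₀).real (Φ l ∩ E) - (K : ℝ)⁻¹ * (P i₀).real E := by
    intro E hE
    rw [integral_congr_ae (ae_restrict_of_ae hgΦ),
      integral_sub ((integrable_const (1 : ℝ)).indicator (hΦ l)) (integrable_const _),
      integral_indicator_const _ (hΦ l), measureReal_restrict_apply (hΦ l), setIntegral_const,
      smul_eq_mul, smul_eq_mul, mul_one, mul_comm (K : ℝ)⁻¹]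
  have hg0 : ∫ x, g x ∂P i₀ = 0 := by
    have := hgB Set.univ MeasurableSet.univ
    simpa [q, integral_couplingDensity_eq_one (P j₀) ha1 he1 hem' he0] using this
  have hgA : ∀ m, ∫ x in A m, g x ∂P i₀ = 0 := by
    intro m
    have hslice : ∀ x, ∫ y in B m, q x y ∂P j₀ = (P j₀).real (B m) +
        (1 / 2 : ℝ) ^ (m + 1) * (a m x * ∫ y in B m, e m y ∂P j₀) := fun x => by
      rw [setIntegral_couplingDensity (P j₀) ha1 he1 hem', tsum_eq_single m]
      intro k hk
      rw [heB' m k hk, mul_zero, mul_zero]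
    have h1 := hgB (B m) (hBm m)
    set c := (1 / 2 : ℝ) ^ (m + 1) * ∫ y in B m, e m y ∂P j₀ with hc
    have hc0 : c ≠ 0 := mul_ne_zero (by positivity) (heB m)
    -- Only the `m`-th term survives on `B m`. Expanding the centred indicator `a m` leaves a
    -- multiple of `g`, of integral zero, and `c ≠ 0` times `g` on `A m`.
    have h2 : ∀ x, g x * ∫ y in B m, q x y ∂P j₀ =
        ((P j₀).real (B m) - c * (P i₀).real (A m)) * g x + c * (A m).indicator g x := by
      intro x
      rw [hslice]
      by_cases hx : x ∈ A m <;> simp [a, hx, hc] <;> ring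
    simp only [h2] at h1
    rw [integral_add (hgint.const_mul _) ((hgint.indicator (hAm m)).const_mul _),
      integral_const_mul, integral_const_mul, hg0, mul_zero, zero_add,
      integral_indicator (hAm m)] at h1
    exact (mul_eq_zero.1 h1).resolve_left hc0
  have hreal : ∀ E, ∫ x in E, g x ∂P i₀ = 0 → MeasurableSet E →
      P i₀ (Φ l ∩ E) = (K : ENNReal)⁻¹ * P i₀ E := by
    intro E h0 hE
    rw [hgE E hE, sub_eq_zero] at h0
    rw [← ENNReal.toReal_eq_toReal_iff' (measure_ne_top _ _)
      (ENNReal.mul_ne_top (by simpa using hK) (measure_ne_top _ _))]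
    simpa [ENNReal.toReal_mul, measureReal_def] using h0
  refine hAdet (Φ l) _ (hΦ l) (fun m => hreal _ (hgA m) (hAm m)) ?_
  simpa using hreal Set.univ (by simpa using hg0) MeasurableSet.univ

theorem proposition1 {n : ℕ} (hn : 2 ≤ n)
    (T : Fin n → Type*) (F : ∀ i, MeasurableSpace (T i))
    [mT : ∀ i, MeasurableSpace (T i)] (hF : ∀ i, F i ≤ mT i)
    (P : ∀ i, Measure (T i)) [∀ i, IsProbabilityMeasure (P i)]
    (hatomless : ∀ i, AtomlessOn (F i) (P i))
    (hcg : ∀ i, EssentiallyCountablyGenerated (F i) (P i))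
    (X : Type*) [MetricSpace X] [CompactSpace X] [Infinite X]
    [MeasurableSpace X] [BorelSpace X]
    (hexists : ∀ G ∈ BayesianGame.typeIrrelevantGames X P, G.HasPayoffRelevantInformation F →
      ∃ f, G.IsPureStrategyEquilibrium f) :
    (∀ i, NowhereEquivalent (F i) (P i)) ∧
      ∀ G ∈ BayesianGame.typeIrrelevantGames X P, G.HasDecomposablePayoffs F → G.HasDCPI F := by
  have hne : ∀ i, NowhereEquivalent (F i) (P i) := by
    intro i D _ hpos heq
    have : Nontrivial (Fin n) := Fin.nontrivial_iff_two_le.2 hn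
    obtain ⟨j, hji⟩ := exists_ne i
    -- More cells than `D` has room for: `1 / K < P D`. The value `K = 0` is excluded because its
    -- inverse is `∞`.
    obtain ⟨K, hK⟩ := ENNReal.exists_inv_nat_lt hpos.ne'
    have hK0 : K ≠ 0 := by
      rintro rfl
      simp at hK
    obtain ⟨Φ, hΦ, hdisj, hcover, hind⟩ := exists_uniform_partition_of_exists_equilibrium hF P
      hexists hji.symm (hatomless j) (hcg i) hK0
    exact absurd (measure_le_of_strongCompletion_eq (hF i) heq hΦ hdisj hcover hind) (not_le.2 hK)
  refine ⟨hne, fun G hG hdec => ⟨fun i => ?_, hdec⟩⟩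
  rw [hG.1 i]
  exact hne i
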